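/- Let $F$ be a field and let $c\colon \alpha\mapsto\alpha^c$ be a non-trivial involution of $F$, i.e. a field automorphism of $F$, different from the identity, with $(\alpha^c)^c=\alpha$ for all $\alpha\in F$. Let $n\ge 2$ and $g=(a_{ij})\in \mathrm{GL}_n(F)$, and put $g^c=(a_{ij}^c)$. A $c$-hermitian form on an $F$-vector space $V$ is a bi-additive map $\sigma\colon V\times V\to F$ with $\sigma(\alpha v,\beta w)=\alpha\beta^c\sigma(v,w)$ and $\sigma(v,w)=\sigma(w,v)^c$ for all $\alpha,\beta\in F$ and $v,w\in V$; its unitary group is the group of all invertible linear maps $T$ of $V$ that preserve it, i.e. $\sigma(Tv,Tw)=\sigma(v,w)$ for all $v,w\in V$. Call $g$ $c$-real if $g$ is conjugate to $(g^c)^{-1}$ in $\mathrm{GL}_n(F)$. Say that $g$ has a unitary representation of dimension $n$ if $g$ is conjugate in $\mathrm{GL}_n(F)$ to an element of the unitary group of some non-degenerate $c$-hermitian form on $F^n$. Then: 1. $g$ is $c$-real if and only if $g$ has a unitary representation of dimension $n$. 2. Equivalently, for every $n$-dimensional $F$-vector space $V$ and every basis of $V$, $g$ is $c$-real if and only if $V$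 admits a non-degenerate $c$-hermitian form preserved by the linear map of $V$ whose matrix in that basis is $g$. -/

import Mathlib

namespace CReal

universe u v

section Reality

variable {F : Type u} [Field F] {n : ℕ}

/-- The entrywise image `g^c = (a_ij^c)` of an invertible matrix `g = (a_ij)`. -/
def conjMatrix (c : F ≃+* F) (g : GL (Fin n) F) : GL (Fin n) F :=
  Matrix.GeneralLinearGroup.map (c : F →+* F) g

/-- `g` is `c`-real: it is conjugate to `(g^c)⁻¹` in `GL_n(F)`. -/
def IsCReal (c : F ≃+* F) (g : GL (Fin n) F) : Prop :=
  IsConj g (conjMatrix c g)⁻¹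

end Reality

section Forms

variable {F : Type u} [Field F] {V : Type v} [AddCommGroup V] [Module F V]

/-- A `c`-sesquilinear form on `V`: bi-additive, with `σ (α v) (β w) = α * c β * σ v w`. -/
abbrev SesqForm (c : F ≃+* F) (V : Type v) [AddCommGroup V] [Module F V] : Type (max u v) :=
  V →ₗ[F] V →ₛₗ[(c : F →+* F)] F

/-- A `c`-sesquilinear form is `c`-hermitian if `σ v w = (σ w v)^c`. -/
def IsHermitianForm {c : F ≃+* F} (σ : SesqForm c V) : Prop :=
  ∀ v w : V, σ v w = c (σ w v)

/-- The unitary group of a form: the invertible linear maps that preserve it. -/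
def unitaryGroup {c : F ≃+* F} (σ : SesqForm c V) :
    Subgroup (LinearMap.GeneralLinearGroup F V) where
  carrier := {T | ∀ v w : V,
    σ ((T : V →ₗ[F] V) v) ((T : V →ₗ[F] V) w) = σ v w}
  mul_mem' := by
    intro S T hS hT v w
    have h := hS ((T : V →ₗ[F] V) v) ((T : V →ₗ[F] V) w)
    simpa [hT v w] using h
  one_mem' := by
    intro v w
    simp
  inv_mem' := by
    intro T hT v w
    have key : ∀ x : V,
        (T : V →ₗ[F] V) (((T⁻¹ : LinearMap.GeneralLinearGroup F V) : V →ₗ[F] V) x) = x := by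
      intro x
      rw [← Module.End.mul_apply, Units.mul_inv, Module.End.one_apply]
    have h := hT (((T⁻¹ : LinearMap.GeneralLinearGroup F V) : V →ₗ[F] V) v)
      (((T⁻¹ : LinearMap.GeneralLinearGroup F V) : V →ₗ[F] V) w)
    rw [key, key] at h
    exact h.symm

/-- `V` admits a `T`-invariant non-degenerate `c`-hermitian form. -/
def AdmitsInvariantForm (c : F ≃+* F) (T : V →ₗ[F] V) : Prop :=
  ∃ σ : SesqForm c V, IsHermitianForm σ ∧ σ.Nondegenerate ∧
    ∀ v w : V, σ (T v) (T w) = σ v w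

end Forms

section UnitaryRepresentation

variable {F : Type u} [Field F] {n : ℕ}

/-- `g ∈ GL_n(F)` has a unitary representation of dimension `n`: it is conjugate in `GL_n(F)`
to an element of the unitary group of some non-degenerate `c`-hermitian form on `F^n`. -/
def HasUnitaryRepresentation (c : F ≃+* F) (g : GL (Fin n) F) : Prop :=
  ∃ σ : SesqForm c (Fin n → F), IsHermitianForm σ ∧ σ.Nondegenerate ∧
    ∃ h : GL (Fin n) F,
      Matrix.GeneralLinearGroup.toLin (h * g * h⁻¹) ∈ unitaryGroup σ

end UnitaryRepresentation

end CReal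

/-! Since `g` is similar to its transpose, `c`-reality says exactly that `gᵀ A g^c = A` for some
invertible `A`: `g` preserves a non-degenerate sesquilinear form σ, not yet hermitian
(`isCReal_iff_exists_matrix`). The asymmetry `u` of σ commutes with `g`, so the Fitting
decomposition of `u + 1` is `g`-stable, and it is σ-orthogonal. Where `u + 1` is invertible, σ + σ*
is non-degenerate; where it is nilpotent, aσ + (aσ)* is, provided `c a ≠ a`
(`AdmitsInvariantForm.of_asymmetry`). No assumption on the characteristic is needed. -/

/-! ### Similarity of a matrix to its transpose -/

open Polynomial DirectSum in
/-- The coefficient functional witnessing that `F[X] / (q)` is a Frobenius algebra. -/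
theorem Polynomial.exists_frobenius_functional {F : Type*} [Field F] {q : F[X]} (hq : q ≠ 0) :
    ∃ l : (F[X] ⧸ Submodule.span F[X] {q}) →ₗ[F] F,
      ∀ x : F[X] ⧸ Submodule.span F[X] {q}, x ≠ 0 → ∃ p : F[X], l (p • x) ≠ 0 := by
  set m := q * C q.leadingCoeff⁻¹ with hm
  have hmon : m.Monic := monic_mul_leadingCoeff_inv hq
  have hdvd : ∀ x, m ∣ x ↔ q ∣ x := fun x => by
    rw [hm, IsUnit.mul_right_dvd]
    exact isUnit_C.2 (by simpa using hq)
  -- The top possible coefficient of the remainder. For `m = 1` the subtraction truncates, but then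
  -- the quotient is zero.
  let l₀ : F[X] →ₗ[F] F := lcoeff F (m.natDegree - 1) ∘ₗ modByMonicHom m
  have hl₀ : (Submodule.span F[X] {q}).restrictScalars F ≤ LinearMap.ker l₀ := by
    intro x hx
    have hx' : q ∣ x := Ideal.mem_span_singleton.1 hx
    have : x %ₘ m = 0 := (modByMonic_eq_zero_iff_dvd hmon).2 ((hdvd x).2 hx')
    simp [l₀, modByMonicHom, this]
  refine ⟨((Submodule.span F[X] {q}).restrictScalars F).liftQ l₀ hl₀, fun x hx => ?_⟩
  obtain ⟨x, rfl⟩ := Submodule.Quotient.mk_surjective _ x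
  have hxm : x %ₘ m ≠ 0 := fun h => hx <| (Submodule.Quotient.mk_eq_zero _).2 <|
    Ideal.mem_span_singleton.2 <| (hdvd x).1 <| (modByMonic_eq_zero_iff_dvd hmon).1 h
  have hne : m ≠ 1 := by
    rintro h
    simp [h] at hxm
  have hdeg : (x %ₘ m).natDegree < m.natDegree := natDegree_modByMonic_lt x hmon hne
  -- This power moves the leading term of the remainder to degree `m.natDegree - 1`, so no further
  -- reduction occurs.
  refine ⟨X ^ (m.natDegree - 1 - (x %ₘ m).natDegree), ?_⟩
  have hmod : (X ^ (m.natDegree - 1 - (x %ₘ m).natDegree) * x) %ₘ m =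
      X ^ (m.natDegree - 1 - (x %ₘ m).natDegree) * (x %ₘ m) := by
    have h1 : (X ^ (m.natDegree - 1 - (x %ₘ m).natDegree) * x) %ₘ m =
        (X ^ (m.natDegree - 1 - (x %ₘ m).natDegree) * (x %ₘ m)) %ₘ m := by
      rw [← sub_eq_zero, ← sub_modByMonic, ← mul_sub, modByMonic_eq_zero_iff_dvd hmon]
      refine Dvd.dvd.mul_left ⟨x /ₘ m, ?_⟩ _
      rw [sub_eq_iff_eq_add, add_comm, modByMonic_add_div]
    rw [h1, modByMonic_eq_self_iff hmon]
    apply degree_lt_degree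
    rw [natDegree_X_pow_mul _ hxm]
    omega
  change l₀ (X ^ (m.natDegree - 1 - (x %ₘ m).natDegree) * x) ≠ 0
  have : l₀ (X ^ (m.natDegree - 1 - (x %ₘ m).natDegree) * x) = (x %ₘ m).leadingCoeff := by
    simp only [l₀, LinearMap.comp_apply, modByMonicHom, LinearMap.coe_mk, AddHom.coe_mk,
      lcoeff_apply, hmod]
    rw [coeff_X_pow_mul', if_pos (by omega), leadingCoeff]
    congr 1
    omega
  rw [this]
  exact leadingCoeff_ne_zero.2 hxm

open Polynomial DirectSum in
/-- Every endomorphism of a finite-dimensional space is self-adjoint for some non-degenerate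
bilinear form. -/
theorem Module.End.exists_selfAdjoint_form {F V : Type*} [Field F] [AddCommGroup V] [Module F V]
    [FiniteDimensional F V] (T : V →ₗ[F] V) :
    ∃ B : V →ₗ[F] V →ₗ[F] F, B.SeparatingLeft ∧ ∀ v w, B (T v) w = B v (T w) := by
  classical
  obtain ⟨ι, _, p, hp, e, ⟨φ⟩⟩ := Module.equiv_directSum_of_isTorsion
    (Module.AEval.isTorsion_of_finiteDimensional F V T)
  choose l hl using fun i => exists_frobenius_functional (pow_ne_zero (e i) (hp i).ne_zero)
  let ψ : V → ∀ i, F[X] ⧸ Ideal.span {p i ^ e i} := fun v i => φ (Module.AEval.of F V T v) i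
  have hψ_add : ∀ v w i, ψ (v + w) i = ψ v i + ψ w i := fun v w i => by simp [ψ]
  have hψ_smul : ∀ (a : F) v i, ψ (a • v) i = a • ψ v i := fun a v i => by
    simp only [ψ, map_smul]
    rw [← Module.AEval.C_smul, map_smul, DirectSum.smul_apply]
    rw [← algebraMap_smul F[X] a]; rfl
  have hψ_T : ∀ v i, ψ (T v) i = Ideal.Quotient.mk _ X * ψ v i := fun v i => by
    have : Module.AEval.of F V T (T v) = (X : F[X]) • Module.AEval.of F V T v :=
      (Module.AEval.X_smul_of T v).symm
    simp only [ψ, this]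
    rw [map_smul, DirectSum.smul_apply]; rfl
  let l' : ∀ i, (F[X] ⧸ Ideal.span {p i ^ e i}) →ₗ[F] F := fun i => l i
  -- `T` acts as multiplication by `X` on each cyclic summand, so commutativity gives
  -- self-adjointness.
  refine ⟨LinearMap.mk₂ F (fun v w => ∑ i, l' i (ψ v i * ψ w i)) ?_ ?_ ?_ ?_, ?_, ?_⟩
  · intro v v' w
    simp [hψ_add, add_mul, Finset.sum_add_distrib]
  · intro a v w
    rw [smul_eq_mul, Finset.mul_sum]
    refine Finset.sum_congr rfl fun i _ => ?_
    rw [hψ_smul]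
    exact (congrArg (l' i) (smul_mul_assoc _ _ _)).trans (map_smul (l' i) _ _)
  · intro v v' w
    simp [hψ_add, mul_add, Finset.sum_add_distrib]
  · intro a v w
    rw [smul_eq_mul, Finset.mul_sum]
    refine Finset.sum_congr rfl fun i _ => ?_
    rw [hψ_smul]
    exact (congrArg (l' i) (mul_smul_comm _ _ _)).trans (map_smul (l' i) _ _)
  · intro v hv
    by_contra hne
    have : φ (Module.AEval.of F V T v) ≠ 0 := by simpa using hne
    obtain ⟨i, hi⟩ : ∃ i, φ (Module.AEval.of F V T v) i ≠ 0 := by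
      by_contra! h
      exact this (DFinsupp.ext h)
    obtain ⟨f, hf⟩ := hl i _ hi
    obtain ⟨w, hw⟩ := (Module.AEval.of F V T).surjective
      (φ.symm (DirectSum.of _ i (Submodule.Quotient.mk f)))
    apply hf
    have h := hv w
    rw [LinearMap.mk₂_apply, Finset.sum_eq_single i] at h
    · convert h using 1
      change l' i _ = _
      congr 1
      simp only [ψ, hw, LinearEquiv.apply_symm_apply, DirectSum.of_eq_same]
      rw [mul_comm]; rfl
    · intro j _ hj
      simp only [ψ, hw, LinearEquiv.apply_symm_apply]
      rw [DirectSum.of_eq_of_ne _ _ _ hj]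
      exact (congrArg (l' j) (mul_zero _)).trans (map_zero _)
    · simp
  · intro v w
    simp only [LinearMap.mk₂_apply, hψ_T]
    refine Finset.sum_congr rfl fun i _ => ?_
    congr 1
    ring

open Matrix

/-- Every square matrix over a field is similar to its transpose. -/
theorem Matrix.exists_transpose_mul_eq_mul {F : Type*} [Field F] {n : ℕ}
    (M : Matrix (Fin n) (Fin n) F) :
    ∃ B : GL (Fin n) F, Mᵀ * (B : Matrix (Fin n) (Fin n) F) = B * M := by
  obtain ⟨B, hB, hT⟩ := Module.End.exists_selfAdjoint_form (Matrix.toLin' M)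
  have hdet : (LinearMap.toMatrix₂' F B).det ≠ 0 :=
    Matrix.separatingLeft_iff_det_ne_zero.1 (LinearMap.separatingLeft_toMatrix₂'_iff.2 hB)
  refine ⟨Matrix.GeneralLinearGroup.mkOfDetNeZero _ hdet, ?_⟩
  change Mᵀ * LinearMap.toMatrix₂' F B = LinearMap.toMatrix₂' F B * M
  rw [LinearMap.mul_toMatrix', LinearMap.toMatrix₂'_mul, transpose_transpose]
  congr 1
  exact LinearMap.ext₂ hT

/-! ### Sesquilinear forms and Gram matrices -/

namespace CReal

/-- The `c`-sesquilinear form with Gram matrix `A` in the basis `b`. -/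
noncomputable def sesqFormOfMatrix {F V : Type*} [Field F] [AddCommGroup V] [Module F V] {n : ℕ}
    (c : F ≃+* F) (b : Module.Basis (Fin n) F V) (A : Matrix (Fin n) (Fin n) F) :
    SesqForm c V :=
  LinearMap.mk₂'ₛₗ (RingHom.id F) (c : F →+* F)
    (fun v w => b.repr v ⬝ᵥ A *ᵥ (c ∘ b.repr w))
    (fun v v' w => by simp [add_dotProduct])
    (fun a v w => by simp [smul_dotProduct])
    (fun v w w' => by
      rw [← dotProduct_add, ← mulVec_add]
      congr 2; ext i; simp)
    (fun a v w => by
      change _ = c a • _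
      rw [← dotProduct_smul, ← mulVec_smul]
      congr 2; ext i; simp)

theorem sesqFormOfMatrix_apply {F V : Type*} [Field F] [AddCommGroup V] [Module F V] {n : ℕ}
    (c : F ≃+* F) (b : Module.Basis (Fin n) F V) (A : Matrix (Fin n) (Fin n) F) (v w : V) :
    sesqFormOfMatrix c b A v w = b.repr v ⬝ᵥ A *ᵥ (c ∘ b.repr w) := rfl

theorem sesqFormOfMatrix_surjective {F V : Type*} [Field F] [AddCommGroup V] [Module F V] {n : ℕ}
    (c : F ≃+* F) (b : Module.Basis (Fin n) F V) (σ : SesqForm c V) :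
    ∃ A, sesqFormOfMatrix c b A = σ := by
  refine ⟨LinearMap.toMatrix₂ b b σ, LinearMap.ext₂ fun v w => ?_⟩
  rw [apply_eq_dotProduct_toMatrix₂_mulVec b b σ]
  rfl

theorem sesqFormOfMatrix_nondegenerate_iff {F V : Type*} [Field F] [AddCommGroup V] [Module F V]
    {n : ℕ} (c : F ≃+* F) (b : Module.Basis (Fin n) F V) (A : Matrix (Fin n) (Fin n) F) :
    (sesqFormOfMatrix c b A).Nondegenerate ↔ A.det ≠ 0 := by
  rw [← Matrix.nondegenerate_iff_det_ne_zero]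
  have hr : ∀ y : Fin n → F, ∃ w, c ∘ b.repr w = y := fun y =>
    ⟨b.equivFun.symm (c.symm ∘ y), by
      ext i
      rw [Function.comp_apply, ← b.equivFun_apply, LinearEquiv.apply_symm_apply]
      simp⟩
  have hl : ∀ x : Fin n → F, ∃ v, ⇑(b.repr v) = x := fun x =>
    ⟨b.equivFun.symm x, by rw [← b.equivFun_apply, LinearEquiv.apply_symm_apply]⟩
  have hl0 : ∀ v, ⇑(b.repr v) = 0 ↔ v = 0 := fun v => by simp
  have hr0 : ∀ v, c ∘ b.repr v = 0 ↔ v = 0 := fun v => by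
    rw [← hl0]
    simp [funext_iff]
  constructor
  · rintro ⟨h1, h2⟩
    refine ⟨separatingLeft_def.2 fun x hx => ?_, separatingRight_def.2 fun y hy => ?_⟩
    · obtain ⟨v, rfl⟩ := hl x
      exact (hl0 v).2 (h1 v fun w => hx _)
    · obtain ⟨w, rfl⟩ := hr y
      exact (hr0 w).2 (h2 w fun v => hy _)
  · rintro ⟨h1, h2⟩
    refine ⟨fun v hv => ?_, fun w hw => ?_⟩
    · refine (hl0 v).1 (separatingLeft_def.1 h1 _ fun y => ?_)
      obtain ⟨w, rfl⟩ := hr y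
      exact hv w
    · refine (hr0 w).1 (separatingRight_def.1 h2 _ fun x => ?_)
      obtain ⟨v, rfl⟩ := hl x
      exact hw v

theorem comp_mulVec {F : Type*} [Field F] {n : ℕ} (c : F ≃+* F)
    (M : Matrix (Fin n) (Fin n) F) (x : Fin n → F) : c ∘ (M *ᵥ x) = M.map c *ᵥ (c ∘ x) := by
  ext i
  simp [mulVec, dotProduct]

theorem sesqFormOfMatrix_toLin {F V : Type*} [Field F] [AddCommGroup V] [Module F V] {n : ℕ}
    (c : F ≃+* F) (b : Module.Basis (Fin n) F V) (A M N : Matrix (Fin n) (Fin n) F) (v w : V) :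
    sesqFormOfMatrix c b A (toLin b b M v) (toLin b b N w) =
      sesqFormOfMatrix c b (Mᵀ * A * N.map c) v w := by
  simp only [sesqFormOfMatrix_apply, Matrix.repr_toLin, comp_mulVec]
  rw [← mulVec_mulVec, ← mulVec_mulVec, dotProduct_mulVec (b.repr v) Mᵀ, vecMul_transpose]

theorem sesqFormOfMatrix_injective {F V : Type*} [Field F] [AddCommGroup V] [Module F V] {n : ℕ}
    (c : F ≃+* F) (b : Module.Basis (Fin n) F V) {A A' : Matrix (Fin n) (Fin n) F}
    (h : ∀ v w, sesqFormOfMatrix c b A v w = sesqFormOfMatrix c b A' v w) : A = A' := by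
  ext i j
  have hs : ∀ j, c ∘ b.repr (b j) = Pi.single j 1 := fun j => by
    ext k
    rcases eq_or_ne k j with rfl | hk <;> simp_all
  have := h (b i) (b j)
  simp only [sesqFormOfMatrix_apply, hs] at this
  simpa [Finsupp.single_eq_pi_single] using this

/-- With `gᵀ = B g B⁻¹`, a conjugator `k` from `g` to `(g^c)⁻¹` corresponds to `A = B k⁻¹`. -/
theorem isCReal_iff_exists_matrix {F : Type*} [Field F] {n : ℕ} (c : F ≃+* F)
    (g : GL (Fin n) F) :
    IsCReal c g ↔ ∃ A : Matrix (Fin n) (Fin n) F, A.det ≠ 0 ∧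
      (g : Matrix (Fin n) (Fin n) F)ᵀ * A * (g : Matrix (Fin n) (Fin n) F).map c = A := by
  obtain ⟨B, hB⟩ := Matrix.exists_transpose_mul_eq_mul (g : Matrix (Fin n) (Fin n) F)
  have hconj : (g : Matrix (Fin n) (Fin n) F).map c = (conjMatrix c g : GL (Fin n) F) := rfl
  have hB' : (g : Matrix (Fin n) (Fin n) F)ᵀ = (B * g * B⁻¹ : GL (Fin n) F) := by
    rw [Units.val_mul, Units.val_mul, ← hB, mul_assoc, Units.mul_inv, mul_one]
  rw [hconj, hB', IsCReal, isConj_iff]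
  constructor
  · rintro ⟨k, hk⟩
    refine ⟨(B * k⁻¹ : GL (Fin n) F), (Matrix.isUnits_det_units _).ne_zero, ?_⟩
    rw [← Units.val_mul, ← Units.val_mul]
    congr 1
    have : conjMatrix c g = k * g⁻¹ * k⁻¹ := by
      rw [← inv_inv (conjMatrix c g), ← hk]; group
    rw [this]; group
  · rintro ⟨A, hA, h⟩
    obtain ⟨A, rfl⟩ : ∃ A' : GL (Fin n) F, A = A' :=
      ⟨Matrix.GeneralLinearGroup.mkOfDetNeZero A hA, rfl⟩
    rw [← Units.val_mul, ← Units.val_mul] at h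
    have h := Units.ext h
    refine ⟨A⁻¹ * B, ?_⟩
    rw [← mul_right_inj A, ← mul_left_inj (conjMatrix c g)]
    conv_rhs => rw [inv_mul_cancel_right, ← h]
    group

/-! ### From an invariant sesquilinear form to a hermitian one -/

set_option maxHeartbeats 1000000 in
/-- A non-degenerate sesquilinear form `σ` with asymmetry `u`, i.e. `σ v (u w) = (σ w v)^c`, that is
preserved by `T` can be replaced by a hermitian one: on the generalized eigenspace of `u` for `-1`
use `a σ + (a σ)^*` with `a` not fixed by `c`, and on its complement `σ + σ^*`. -/
theorem AdmitsInvariantForm.of_asymmetry {F V : Type*} [Field F] [AddCommGroup V] [Module F V]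
    [FiniteDimensional F V] {c : F ≃+* F} (hinv : ∀ a, c (c a) = a) {a : F} (ha : c a ≠ a)
    {σ : SesqForm c V} (hσ : σ.Nondegenerate) {u T : V →ₗ[F] V}
    (hu : ∀ v w, σ v (u w) = c (σ w v)) (hT : Function.Surjective T)
    (hTσ : ∀ v w, σ (T v) (T w) = σ v w) : AdmitsInvariantForm c T := by
  have cancel : ∀ {x y}, (∀ v, σ v x = σ v y) → x = y := fun {x y} h =>
    sub_eq_zero.1 <| hσ.2 _ fun v => by rw [map_sub, h, sub_self]
  have huu : ∀ v w, σ (u v) (u w) = σ v w := fun v w => by rw [hu, hu, hinv]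
  have huT : ∀ w, u (T w) = T (u w) := fun w => cancel fun v => by
    obtain ⟨v, rfl⟩ := hT v
    rw [hu, hTσ, hTσ, hu]
  have hu_inj : Function.Injective u := fun x y h => cancel fun v => by
    rw [← huu, h, huu]
  have hu_surj : Function.Surjective u := LinearMap.surjective_of_injective hu_inj
  let N : Module.End F V := u + 1
  have hN : ∀ w, N w = u w + w := fun w => rfl
  have hNu : ∀ k w, (N ^ k) (u w) = u ((N ^ k) w) := fun k w => by
    have : Commute N u := (Commute.refl u).add_left (Commute.one_left u)
    exact LinearMap.congr_fun (this.pow_left k) w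
  have hNT : ∀ k w, (N ^ k) (T w) = T ((N ^ k) w) := fun k w => by
    have : Commute u T := LinearMap.ext huT
    have : Commute N T := this.add_left (Commute.one_left T)
    exact LinearMap.congr_fun (this.pow_left k) w
  -- Induction on `σ (u v) (N w) = σ (N v) w`, which holds because `u` preserves σ.
  have orth : ∀ k v w, (N ^ k) v = 0 → σ v ((N ^ k) w) = 0 := by
    intro k
    induction k with
    | zero =>
      intro v w h
      rw [pow_zero, Module.End.one_apply] at h
      rw [h, map_zero, LinearMap.zero_apply]
    | succ k ih =>
      intro v w h
      obtain ⟨v, rfl⟩ := hu_surj v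
      have h0 : (N ^ k) (N v) = 0 := by
        rw [hNu] at h
        have := hu_inj (h.trans (map_zero u).symm)
        rwa [pow_succ, Module.End.mul_apply] at this
      rw [pow_succ', Module.End.mul_apply, hN, map_add, huu]
      have := ih _ w h0
      rwa [hN, map_add, LinearMap.add_apply, add_comm] at this
  have orth' : ∀ k v w, (N ^ k) v = 0 → σ ((N ^ k) w) v = 0 := fun k v w h => by
    have := orth k v (u w) h
    rwa [hNu, hu, map_eq_zero] at this
  -- Fitting decomposition; `1 ≤ k` ensures that the range of `N ^ k` lies in that of `N`.
  obtain ⟨k, hk, hk1⟩ := ((LinearMap.eventually_isCompl_ker_pow_range_pow N).and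
    (Filter.eventually_ge_atTop 1)).exists
  let e := (LinearMap.ker (N ^ k)).projection (LinearMap.range (N ^ k)) hk
  have heP : ∀ v, (N ^ k) (e v) = 0 := fun v =>
    (Submodule.projection_apply_mem hk v : _ ∈ LinearMap.ker (N ^ k))
  have heR : ∀ v, ∃ y, (N ^ k) y = v - e v := fun v =>
    (Submodule.sub_projection_mem hk v : _ ∈ LinearMap.range (N ^ k))
  have he_of : ∀ v, (N ^ k) v = 0 → e v = v := fun v h =>
    Submodule.projection_apply_of_mem_left hk h
  have he_range : ∀ y, e ((N ^ k) y) = 0 := fun y =>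
    (Submodule.projection_apply_eq_zero_iff hk).2 ⟨y, rfl⟩
  have heT : ∀ w, e (T w) = T (e w) := fun w => by
    obtain ⟨y, hy⟩ := heR w
    have h1 : T w = T (e w) + (N ^ k) (T y) := by rw [hNT, hy, map_sub]; abel
    rw [h1, map_add, he_range, add_zero, he_of]
    rw [hNT, heP, map_zero]
  -- a vector orthogonal to both summands vanishes
  have sep : ∀ x, (∀ y, (N ^ k) y = 0 → σ x y = 0) → (∀ y, σ x ((N ^ k) y) = 0) → x = 0 :=
    fun x h1 h2 => hσ.1 _ fun w => by
      obtain ⟨y, hy⟩ := heR w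
      rw [← sub_add_cancel w (e w), map_add, ← hy, h2, h1 _ (heP w), add_zero]
  -- `D = (c a - a) + a N` is a nonzero scalar plus a nilpotent on the kernel of `N ^ k`.
  let D : V →ₗ[F] V := c a • LinearMap.id + a • u
  have hD : ∀ x y, σ x (D y) = a * σ x y + c (a * σ y x) := fun x y => by
    simp [D, hu, hinv]
  have hNσ : ∀ x y, σ x (N y) = σ x y + c (σ y x) := fun x y => by
    rw [hN, map_add, hu, add_comm]
  let τ : SesqForm c V := LinearMap.mk₂'ₛₗ (RingHom.id F) (c : F →+* F)
    (fun v w => σ (v - e v) (N (w - e w)) + σ (e v) (D (e w)))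
    (fun v v' w => by simp only [map_add, map_sub, LinearMap.add_apply, LinearMap.sub_apply]; ring)
    (fun r v w => by
      simp only [map_smul, map_sub, LinearMap.smul_apply, LinearMap.sub_apply, smul_eq_mul,
        RingHom.id_apply]; ring)
    (fun v w w' => by simp only [map_add, map_sub]; ring)
    (fun r v w => by
      simp only [map_smul, map_smulₛₗ, map_sub, smul_eq_mul]; ring)
  have hτ : ∀ v w, τ v w = σ (v - e v) (N (w - e w)) + σ (e v) (D (e w)) := fun v w => rfl
  have herm : IsHermitianForm τ := fun v w => by
    rw [hτ, hτ, hD, hD, hNσ, hNσ]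
    simp only [map_add, map_mul, hinv]
    ring
  have hleft : τ.SeparatingLeft := by
    intro v hv
    have h1 : v - e v = 0 := by
      obtain ⟨x, hx⟩ := heR v
      have hP : ∀ y, (N ^ k) y = 0 → σ (v - e v) y = 0 := fun y hy => by
        rw [← hx]; exact orth' k y x hy
      have hN0 : ∀ w, σ (v - e v) (N w) = 0 := fun w => by
        have hR := hv (w - e w)
        obtain ⟨y, hy⟩ := heR w
        have he0 : e (w - e w) = 0 := by rw [← hy, he_range]
        rw [hτ, he0, map_zero, map_zero, add_zero, sub_zero] at hR
        rw [← sub_add_cancel w (e w), map_add, map_add, hR, zero_add]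
        apply hP
        rw [← Module.End.mul_apply, ← pow_succ, pow_succ', Module.End.mul_apply, heP, map_zero]
      refine sep _ hP fun y => ?_
      obtain ⟨j, rfl⟩ := Nat.exists_eq_add_of_le' hk1
      rw [pow_succ', Module.End.mul_apply, hN0]
    have h2 : e v = 0 := by
      have hD0 : ∀ y, (N ^ k) y = 0 → σ (e v) (D y) = 0 := fun y hy => by
        have := hv y
        rwa [hτ, h1, map_zero, LinearMap.zero_apply, zero_add, he_of y hy] at this
      refine sep _ ?_ fun y => orth k _ y (heP v)
      -- Climbing the kernels of `N ^ j`: `N y` is already orthogonal to `e v`, and modulo `N y` the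
      -- vector `D y` is `(c a - a) y`.
      suffices ∀ j ≤ k, ∀ y, (N ^ j) y = 0 → σ (e v) y = 0 from this k le_rfl
      intro j
      induction j with
      | zero =>
        intro _ y hy
        rw [pow_zero, Module.End.one_apply] at hy
        rw [hy, map_zero]
      | succ j ih =>
        intro hj y hy
        have hNy : σ (e v) (N y) = 0 := ih (by omega) _ (by
          rwa [pow_succ, Module.End.mul_apply] at hy)
        have hy' : (N ^ k) y = 0 := by
          obtain ⟨i, rfl⟩ := Nat.exists_eq_add_of_le' hj
          rw [pow_add, Module.End.mul_apply, hy, map_zero]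
        have hDy := hD0 y hy'
        rw [hD, map_mul] at hDy
        rw [hNσ] at hNy
        have : (a - c a) * σ (e v) y = 0 := by linear_combination hDy - c a * hNy
        exact (mul_eq_zero.1 this).resolve_left (sub_ne_zero.2 ha.symm)
    rw [← sub_add_cancel v (e v), h1, h2, add_zero]
  refine ⟨τ, herm, ⟨hleft, fun w hw => hleft w fun v => ?_⟩, fun v w => ?_⟩
  · rw [herm, hw, map_zero]
  · have hT' : ∀ w, T w - e (T w) = T (w - e w) := fun w => by rw [heT, map_sub]
    have hcN : ∀ w, N (T w) = T (N w) := by simpa using hNT 1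
    have hcD : ∀ w, D (T w) = T (D w) := fun w => by simp [D, huT]
    rw [hτ, hτ, hT', hT', heT, heT, hcN, hcD, hTσ, hTσ]

/-! ### Reality and invariant hermitian forms -/

theorem admitsInvariantForm_iff_isCReal {F V : Type*} [Field F] [AddCommGroup V] [Module F V]
    {n : ℕ} (c : F ≃+* F) (hinv : ∀ a, c (c a) = a) (hc : c ≠ RingEquiv.refl F)
    (b : Module.Basis (Fin n) F V) (g : GL (Fin n) F) :
    IsCReal c g ↔ AdmitsInvariantForm c (toLin b b (g : Matrix (Fin n) (Fin n) F)) := by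
  rw [isCReal_iff_exists_matrix]
  constructor
  · rintro ⟨A, hA, h⟩
    obtain ⟨a, ha⟩ : ∃ a, c a ≠ a := by
      by_contra! h
      exact hc (RingEquiv.ext h)
    have : FiniteDimensional F V := b.finiteDimensional_of_finite
    have hcc : ∀ M : Matrix (Fin n) (Fin n) F, (M.map c).map c = M := fun M => by
      ext; simp [hinv]
    -- The matrix `U` of the asymmetry solves `A U^c = (A^c)ᵀ`.
    refine AdmitsInvariantForm.of_asymmetry (u := toLin b b ((A⁻¹ * (A.map c)ᵀ).map c)) hinv ha
      ((sesqFormOfMatrix_nondegenerate_iff c b A).2 hA) (fun v w => ?_) ?_ (fun v w => ?_)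
    · have h1 := sesqFormOfMatrix_toLin c b A 1 ((A⁻¹ * (A.map c)ᵀ).map c) v w
      rw [toLin_one, LinearMap.id_apply] at h1
      rw [h1, hcc, transpose_one, one_mul, mul_nonsing_inv_cancel_left _ _ (isUnit_iff_ne_zero.2 hA),
        sesqFormOfMatrix_apply, sesqFormOfMatrix_apply]
      have h2 : ∀ x y : Fin n → F, c (x ⬝ᵥ y) = (c ∘ x) ⬝ᵥ (c ∘ y) := fun x y => by
        simp [dotProduct]
      rw [h2, comp_mulVec, mulVec_transpose, dotProduct_comm, ← dotProduct_mulVec]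
      congr 2
      ext i; simp [hinv]
    · intro w
      refine ⟨toLin b b (g⁻¹ : GL (Fin n) F) w, ?_⟩
      rw [← toLin_mul_apply, ← Units.val_mul, mul_inv_cancel, Units.val_one, toLin_one,
        LinearMap.id_apply]
    · rw [sesqFormOfMatrix_toLin, h]
  · rintro ⟨σ, -, hσ, hT⟩
    obtain ⟨A, rfl⟩ := sesqFormOfMatrix_surjective c b σ
    refine ⟨A, (sesqFormOfMatrix_nondegenerate_iff c b A).1 hσ,
      sesqFormOfMatrix_injective c b fun v w => ?_⟩
    rw [← sesqFormOfMatrix_toLin, hT]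

theorem isCReal_conj_iff {F : Type*} [Field F] {n : ℕ} (c : F ≃+* F) (g h : GL (Fin n) F) :
    IsCReal c (h * g * h⁻¹) ↔ IsCReal c g := by
  have h1 : IsConj g (h * g * h⁻¹) := isConj_iff.2 ⟨h, rfl⟩
  have h2 : IsConj (conjMatrix c g)⁻¹ (conjMatrix c (h * g * h⁻¹))⁻¹ :=
    isConj_iff.2 ⟨conjMatrix c h, by simp [conjMatrix, mul_assoc]⟩
  exact ⟨fun H => (h1.trans H).trans h2.symm, fun H => (h1.symm.trans H).trans h2⟩

theorem hasUnitaryRepresentation_iff {F : Type*} [Field F] {n : ℕ} (c : F ≃+* F)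
    (g : GL (Fin n) F) :
    HasUnitaryRepresentation c g ↔ ∃ h : GL (Fin n) F,
      AdmitsInvariantForm c (toLin (Pi.basisFun F (Fin n)) (Pi.basisFun F (Fin n))
        ((h * g * h⁻¹ : GL (Fin n) F) : Matrix (Fin n) (Fin n) F)) := by
  constructor
  · rintro ⟨σ, h1, h2, h, h3⟩
    exact ⟨h, σ, h1, h2, h3⟩
  · rintro ⟨h, σ, h1, h2, h3⟩
    exact ⟨σ, h1, h2, h, h3⟩

end CReal

theorem theorem1p1 {F : Type*} [Field F] (c : F ≃+* F)
    (hinv : ∀ a : F, c (c a) = a) (hnontriv : c ≠ RingEquiv.refl F)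
    (n : ℕ) (hn : 2 ≤ n) (g : GL (Fin n) F) :
    (CReal.IsCReal c g ↔ CReal.HasUnitaryRepresentation c g) ∧
    (∀ (V : Type*) [AddCommGroup V] [Module F V] (b : Module.Basis (Fin n) F V),
      CReal.IsCReal c g ↔
        CReal.AdmitsInvariantForm c (Matrix.toLin b b (g : Matrix (Fin n) (Fin n) F))) := by
  refine ⟨?_, fun V _ _ b => CReal.admitsInvariantForm_iff_isCReal c hinv hnontriv b g⟩
  -- Reality depends only on the conjugacy class, so the quantifier over the conjugator is vacuous.
  simp_rw [CReal.hasUnitaryRepresentation_iff,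
    ← CReal.admitsInvariantForm_iff_isCReal c hinv hnontriv, CReal.isCReal_conj_iff, exists_const]
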